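/- Let $\alpha>0$ and let $G$ be the gamma distribution with shape $\alpha$ and scale $1$, i.e. the probability law on $[0,\infty)$ with Laplace transform $\int e^{-sx}\,dG(x)=1/(1+s)^{\alpha}$, $s\ge 0$; write $G(x)$ also for its distribution function. Let $p\in(0,1)$ and $q=1-p$. Then the renewal equation $$Z(x)=p\,G(x)+q\int_{[0,x]}Z(x-y)\,dG(y),\qquad x\in\mathbb R,$$ has exactly one solution $Z$ among the Borel functions on $\mathbb R$ that vanish on $(-\infty,0)$ and are bounded on bounded intervals. This $Z$ is the distribution function of a probability law, and this law is geometrically infinitely divisible if and only if $\alpha\le 1$. Here a probability law $\mu$ on $\mathbb R$ is called geometrically infinitely divisible (GID) if for every $r\in(0,1)$ there is a probability law $\nu_r$ on $\mathbb R$ such that $\mu$ is the law of $X_1+\dots+X_{N}$, where $X_1,X_2,\dots$ are independent with law $\nu_r$ and $N$ is independent of them with $P(N=k)=r(1-r)^{k-1}$, $k=1,2,\dots$. -/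

import Mathlib

open MeasureTheory ProbabilityTheory Set

namespace RenewalGID

noncomputable section

/-- `Z` solves the renewal equation `Z(x) = z(x) + (Z * F)(x)`, where `F` is a measure on `[0, ∞)`
and `(Z * F)(x) = ∫_{[0,x]} Z(x - y) F(dy)`. As usual in renewal theory, solutions are Borel
functions that vanish on `(-∞, 0)` and are bounded on bounded intervals. -/
structure IsRenewalSolution (z : ℝ → ℝ) (F : Measure ℝ) (Z : ℝ → ℝ) : Prop where
  measurable : Measurable Z
  eq_zero_of_neg : ∀ x < 0, Z x = 0
  locally_bounded : ∀ T : ℝ, ∃ C : ℝ, ∀ x ∈ Icc 0 T, |Z x| ≤ C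
  equation : ∀ x : ℝ, Z x = z x + ∫ y in Icc 0 x, Z (x - y) ∂F

/-- The `n`-fold convolution power of `ν`: the law of the sum of `n` independent random variables
with law `ν`. -/
def convPow (ν : Measure ℝ) : ℕ → Measure ℝ
  | 0 => Measure.dirac 0
  | n + 1 => Measure.conv (convPow ν n) ν

/-- The law of `X₁ + ⋯ + X_N`, where the `Xᵢ` are independent with law `ν` and `N` is independent
of them and geometric on `{1, 2, …}`: `P(N = n + 1) = r (1 - r) ^ n` for `n ≥ 0`. -/
def geometricSumLaw (r : ℝ) (ν : Measure ℝ) : Measure ℝ :=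
  Measure.sum fun n : ℕ => ENNReal.ofReal (r * (1 - r) ^ n) • convPow ν (n + 1)

/-- Geometric infinite divisibility: for every `r ∈ (0, 1)`, `μ` is the law of a geometric sum,
with parameter `r`, of independent identically distributed random variables (whose common law `ν`
may depend on `r`). -/
def IsGID (μ : Measure ℝ) : Prop :=
  ∀ r ∈ Ioo (0 : ℝ) 1, ∃ ν : Measure ℝ, IsProbabilityMeasure ν ∧ μ = geometricSumLaw r ν

/-- The Laplace transform of the gamma law with shape `α` and rate `1` is `1 / (1 + s) ^ α`. -/
theorem laplace_gammaMeasure (α : ℝ) (hα : 0 < α) (s : ℝ) (hs : 0 ≤ s) :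
    ∫ x, Real.exp (-(s * x)) ∂(gammaMeasure α 1) = 1 / (1 + s) ^ α := by
  have h1 : (0 : ℝ) < 1 + s := by linarith
  have hG := Real.Gamma_pos_of_pos hα
  rw [gammaMeasure, integral_withDensity_eq_integral_toReal_smul (f := gammaPDF α 1)
    (measurable_gammaPDFReal α 1).ennreal_ofReal
    (Filter.Eventually.of_forall fun x => ENNReal.ofReal_lt_top)]
  have h2 : ∀ x : ℝ, (gammaPDF α 1 x).toReal • Real.exp (-(s * x)) =
      (Ici (0 : ℝ)).indicator
        (fun x => (1 / Real.Gamma α) * (x ^ (α - 1) * Real.exp (-((1 + s) * x)))) x := by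
    intro x
    rw [gammaPDF, ENNReal.toReal_ofReal (gammaPDFReal_nonneg hα one_pos x), gammaPDFReal]
    by_cases hx : 0 ≤ x
    · rw [if_pos hx, indicator_of_mem (mem_Ici.2 hx), Real.one_rpow, smul_eq_mul,
        show -((1 + s) * x) = -(1 * x) + -(s * x) by ring, Real.exp_add]
      ring
    · rw [if_neg hx, indicator_of_notMem (by simpa using hx), zero_smul]
  simp_rw [h2]
  rw [integral_indicator measurableSet_Ici, integral_Ici_eq_integral_Ioi, integral_const_mul,
    Real.integral_rpow_mul_exp_neg_mul_Ioi hα h1, Real.div_rpow zero_le_one h1.le, Real.one_rpow]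
  field_simp

end

end RenewalGID

namespace RenewalGID

noncomputable section

/-! The solution is the distribution function of the geometric sum `geometricSumLaw p G`: splitting
off one summand gives the renewal equation, and since `q G` has mass less than 1, two locally
bounded solutions must agree.

Write `g`, `m`, `n` for the transforms of `G`, of this law and of a candidate `ν_r`. Geometric
summation with parameter `r` divides `1/n - 1` by `r`, so the only possible choice satisfies `1/n -
1 = (r/p) (1/g - 1)`, that is `n(s) = p / (p + r ((1 + s)^α - 1))` in Laplace form. The question is
whether this is the transform of a probability law for every `r`.

If `α > 1`, the inequality `∫ (1 - e^{-x})² dν ≥ 0` fails for small `r`, because `n` is then `1 -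
(r/p) ((1 + s)^α - 1)` to first order and `t ↦ t^α` is strictly convex.

If `α ≤ 1`, the case `r ≥ p` is a geometric sum of gamma variables (or the gamma law itself). For `r
< p` put `c = r/p` and `k = (1 - c)/c`; the law has density `x^(α-1) e^{-x} E_{α,α}(-k x^α) / c`.
The Volterra equation of the Mittag-Leffler factor (`mittagLefflerNeg_volterra`) is the required
convolution identity with the gamma law, and `mittagLefflerNeg_pos` makes the density nonnegative.
-/

/-! ### Geometric sums and their characteristic functions -/

instance isProbabilityMeasure_convPow (ν : Measure ℝ) [IsProbabilityMeasure ν] (n : ℕ) :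
    IsProbabilityMeasure (convPow ν n) := by
  induction n with
  | zero => exact inferInstanceAs (IsProbabilityMeasure (Measure.dirac 0))
  | succ n ih => exact inferInstanceAs (IsProbabilityMeasure (Measure.conv (convPow ν n) ν))

/-- Conditioning on whether the geometric sum has exactly one term. -/
theorem geometricSumLaw_eq {r : ℝ} (hr : r ∈ Ioo (0 : ℝ) 1) (ν : Measure ℝ)
    [IsProbabilityMeasure ν] :
    geometricSumLaw r ν = ENNReal.ofReal r • ν +
      ENNReal.ofReal (1 - r) • Measure.conv (geometricSumLaw r ν) ν := by
  refine Measure.ext_of_lintegral _ fun f hf ↦ ?_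
  have hf' : Measurable fun x : ℝ ↦ ∫⁻ y, f (x + y) ∂ν := by fun_prop
  rw [lintegral_add_measure, lintegral_smul_measure, lintegral_smul_measure,
    Measure.lintegral_conv hf, geometricSumLaw, lintegral_sum_measure, lintegral_sum_measure,
    tsum_eq_zero_add' ENNReal.summable, smul_eq_mul, smul_eq_mul, ← ENNReal.tsum_mul_left]
  congr 1
  · simp [convPow]
  · refine tsum_congr fun n ↦ ?_
    rw [lintegral_smul_measure, lintegral_smul_measure, ← Measure.lintegral_conv hf, smul_eq_mul,
      smul_eq_mul, ← mul_assoc, ← ENNReal.ofReal_mul (sub_nonneg.2 hr.2.le),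
      show (1 - r) * (r * (1 - r) ^ n) = r * (1 - r) ^ (n + 1) by ring]
    rfl

theorem isProbabilityMeasure_geometricSumLaw {r : ℝ} (hr : r ∈ Ioo (0 : ℝ) 1) (ν : Measure ℝ)
    [IsProbabilityMeasure ν] : IsProbabilityMeasure (geometricSumLaw r ν) := by
  have h1 : 0 ≤ 1 - r := sub_nonneg.2 hr.2.le
  have hs := (hasSum_geometric_of_lt_one h1 (by linarith [hr.1])).mul_left r
  refine ⟨?_⟩
  rw [geometricSumLaw, Measure.sum_apply _ MeasurableSet.univ]
  simp only [Measure.smul_apply, measure_univ, smul_eq_mul, mul_one]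
  rw [← ENNReal.ofReal_tsum_of_nonneg (fun n ↦ mul_nonneg hr.1.le (pow_nonneg h1 n)) hs.summable,
    hs.tsum_eq, sub_sub_cancel, mul_inv_cancel₀ hr.1.ne', ENNReal.ofReal_one]

theorem charFun_ofReal_smul {a : ℝ} (ha : 0 ≤ a) (μ : Measure ℝ) (t : ℝ) :
    charFun (ENNReal.ofReal a • μ) t = a * charFun μ t := by
  simp [charFun_apply_real, integral_smul_measure, ENNReal.toReal_ofReal ha]

theorem charFun_add (μ ν : Measure ℝ) [IsFiniteMeasure μ] [IsFiniteMeasure ν] (t : ℝ) :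
    charFun (μ + ν) t = charFun μ t + charFun ν t := by
  have h : ∀ (ρ : Measure ℝ) [IsFiniteMeasure ρ],
      Integrable (fun x : ℝ ↦ Complex.exp (t * x * Complex.I)) ρ := fun ρ _ ↦ by
    refine Integrable.of_bound (C := 1) (by fun_prop) (.of_forall fun x ↦ le_of_eq ?_)
    rw [← Complex.ofReal_mul, Complex.norm_exp_ofReal_mul_I]
  simp only [charFun_apply_real]
  exact integral_add_measure (h μ) (h ν)

theorem charFun_geometricSumLaw {r : ℝ} (hr : r ∈ Ioo (0 : ℝ) 1) (ν : Measure ℝ)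
    [IsProbabilityMeasure ν] (t : ℝ) :
    charFun (geometricSumLaw r ν) t =
      r * charFun ν t + (1 - r) * (charFun (geometricSumLaw r ν) t * charFun ν t) := by
  have := isProbabilityMeasure_geometricSumLaw hr ν
  have : IsFiniteMeasure (ENNReal.ofReal r • ν) := Measure.smul_finite _ ENNReal.ofReal_ne_top
  have : IsFiniteMeasure (ENNReal.ofReal (1 - r) • Measure.conv (geometricSumLaw r ν) ν) :=
    Measure.smul_finite _ ENNReal.ofReal_ne_top
  conv_lhs => rw [geometricSumLaw_eq hr ν]
  rw [charFun_add, charFun_ofReal_smul hr.1.le, charFun_ofReal_smul (sub_nonneg.2 hr.2.le),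
    charFun_conv]
  push_cast
  rfl

/-- The product has modulus at most `1 - r < 1`. This allows the linear equation for the
characteristic function of a geometric sum to be solved uniquely. -/
theorem one_sub_mul_charFun_ne_zero {r : ℝ} (hr : r ∈ Ioo (0 : ℝ) 1) (ν : Measure ℝ)
    [IsProbabilityMeasure ν] (t : ℝ) : 1 - (1 - (r : ℂ)) * charFun ν t ≠ 0 := by
  intro h
  have h1 : ‖(1 - (r : ℂ)) * charFun ν t‖ = 1 := by rw [← sub_eq_zero.1 h, norm_one]
  have h2 : ‖(1 - (r : ℂ))‖ = 1 - r := by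
    rw [← Complex.ofReal_one, ← Complex.ofReal_sub, Complex.norm_real, Real.norm_eq_abs,
      abs_of_pos (sub_pos.2 hr.2)]
  rw [norm_mul, h2] at h1
  nlinarith [norm_charFun_le_one (μ := ν) t, hr.1, hr.2]

/-- A finite measure is the geometric sum law as soon as its characteristic function satisfies the
corresponding equation. -/
theorem eq_geometricSumLaw_of_charFun {r : ℝ} (hr : r ∈ Ioo (0 : ℝ) 1) (μ ν : Measure ℝ)
    [IsFiniteMeasure μ] [IsProbabilityMeasure ν]
    (h : ∀ t, charFun μ t = r * charFun ν t + (1 - r) * (charFun μ t * charFun ν t)) :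
    μ = geometricSumLaw r ν := by
  have := isProbabilityMeasure_geometricSumLaw hr ν
  refine Measure.ext_of_charFun (funext fun t ↦ ?_)
  refine mul_left_cancel₀ (one_sub_mul_charFun_ne_zero hr ν t) ?_
  linear_combination h t - charFun_geometricSumLaw hr ν t

/-! ### The renewal equation: existence and uniqueness -/

theorem convPow_Iio_zero (ν : Measure ℝ) [IsProbabilityMeasure ν] (hν : ν (Iio 0) = 0) (n : ℕ) :
    convPow ν n (Iio 0) = 0 := by
  induction n with
  | zero => simp [convPow]
  | succ n ih =>
    have h1 : ∀ᵐ x ∂(convPow ν n), 0 ≤ x := by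
      rw [ae_iff]; simpa [not_le, Iio] using ih
    have h2 : ∀ᵐ y ∂ν, 0 ≤ y := by
      rw [ae_iff]; simpa [not_le, Iio] using hν
    rw [convPow, ← lintegral_indicator_one measurableSet_Iio,
      Measure.lintegral_conv (measurable_one.indicator measurableSet_Iio)]
    refine lintegral_eq_zero_of_ae_eq_zero ?_
    filter_upwards [h1] with x hx
    refine lintegral_eq_zero_of_ae_eq_zero ?_
    filter_upwards [h2] with y hy
    simp [(add_nonneg hx hy).not_gt]

theorem geometricSumLaw_Iio_zero (r : ℝ) (ν : Measure ℝ) [IsProbabilityMeasure ν]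
    (hν : ν (Iio 0) = 0) : geometricSumLaw r ν (Iio 0) = 0 := by
  rw [geometricSumLaw, Measure.sum_apply _ measurableSet_Iio]
  simp [convPow_Iio_zero ν hν]

/-- The renewal equation for distribution functions. -/
theorem isRenewalSolution_cdf_geometricSumLaw {p : ℝ} (hp : p ∈ Ioo (0 : ℝ) 1) (G : Measure ℝ)
    [IsProbabilityMeasure G] (hG : G (Iio 0) = 0) :
    IsRenewalSolution (fun x ↦ p * cdf G x) (ENNReal.ofReal (1 - p) • G)
      (fun x ↦ cdf (geometricSumLaw p G) x) := by
  have := isProbabilityMeasure_geometricSumLaw hp G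
  have hq : 0 ≤ 1 - p := sub_nonneg.2 hp.2.le
  have hmono : Monotone fun x ↦ cdf (geometricSumLaw p G) x := monotone_cdf _
  have hconv : ∀ x, Measure.conv (geometricSumLaw p G) G (Iic x) =
      ∫⁻ y, geometricSumLaw p G (Iic (x - y)) ∂G := fun x ↦ by
    rw [Measure.conv_comm, ← lintegral_indicator_one measurableSet_Iic,
      Measure.lintegral_conv (measurable_one.indicator measurableSet_Iic)]
    refine lintegral_congr fun y ↦ ?_
    rw [← lintegral_indicator_one measurableSet_Iic]
    refine lintegral_congr fun z ↦ ?_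
    simp [indicator_apply, le_sub_iff_add_le']
  have hzero : ∀ x < 0, geometricSumLaw p G (Iic x) = 0 := fun x hx ↦
    measure_mono_null (Iic_subset_Iio.2 hx) (geometricSumLaw_Iio_zero p G hG)
  have hzero' : ∀ x < 0, cdf (geometricSumLaw p G) x = 0 := fun x hx ↦ by
    rw [cdf_eq_real, measureReal_def, hzero x hx, ENNReal.toReal_zero]
  refine ⟨hmono.measurable, hzero', fun T ↦ ⟨1, fun x _ ↦ ?_⟩, fun x ↦ ?_⟩
  · rw [abs_of_nonneg (cdf_nonneg _ _)]
    exact cdf_le_one _ _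
  · have h2 : ∀ᵐ y ∂G, 0 ≤ y := by
      rw [ae_iff]; simpa [not_le, Iio] using hG
    have hmeas : Measurable fun y ↦ cdf (geometricSumLaw p G) (x - y) :=
      hmono.measurable.comp (by fun_prop)
    have h3 : ∫ y in Icc 0 x, cdf (geometricSumLaw p G) (x - y) ∂G =
        (Measure.conv (geometricSumLaw p G) G (Iic x)).toReal := by
      rw [← integral_indicator measurableSet_Icc, hconv,
        integral_congr_ae (g := fun y ↦ cdf (geometricSumLaw p G) (x - y)),
        integral_eq_lintegral_of_nonneg_ae (.of_forall fun y ↦ cdf_nonneg _ _)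
          hmeas.aestronglyMeasurable]
      · congr 1
        refine lintegral_congr fun y ↦ ?_
        rw [cdf_eq_real, ofReal_measureReal]
      · filter_upwards [h2] with y hy
        by_cases hyx : y ≤ x
        · rw [indicator_of_mem (mem_Icc.2 ⟨hy, hyx⟩)]
        · rw [indicator_of_notMem fun h ↦ hyx h.2, hzero' _ (by linarith)]
    rw [Measure.restrict_smul, integral_smul_measure, h3, ENNReal.toReal_ofReal hq, smul_eq_mul,
      cdf_eq_real, cdf_eq_real, measureReal_def, measureReal_def]
    conv_lhs => rw [geometricSumLaw_eq hp G]
    rw [Measure.add_apply, Measure.smul_apply, Measure.smul_apply, smul_eq_mul, smul_eq_mul,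
      ENNReal.toReal_add (ENNReal.mul_ne_top ENNReal.ofReal_ne_top (measure_ne_top _ _))
        (ENNReal.mul_ne_top ENNReal.ofReal_ne_top (measure_ne_top _ _)), ENNReal.toReal_mul,
      ENNReal.toReal_mul, ENNReal.toReal_ofReal hp.1.le, ENNReal.toReal_ofReal hq]

/-- The renewal equation with a defective `F` has at most one locally bounded solution. -/
theorem IsRenewalSolution.unique {z : ℝ → ℝ} {F : Measure ℝ} [IsFiniteMeasure F]
    (hF : F.real univ < 1) {Z Z' : ℝ → ℝ} (hZ : IsRenewalSolution z F Z)
    (hZ' : IsRenewalSolution z F Z') : Z = Z' := by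
  funext x
  by_cases hx : x < 0
  · rw [hZ.eq_zero_of_neg x hx, hZ'.eq_zero_of_neg x hx]
  have hmem : ∀ T : ℝ, ∀ w ∈ Icc 0 T, ∀ y ∈ Icc 0 w, w - y ∈ Icc 0 T := fun T w hw y hy ↦
    ⟨by linarith [hy.2], by linarith [hy.1, hw.2]⟩
  have hint : ∀ Y, IsRenewalSolution z F Y → ∀ w ∈ Icc 0 x,
      IntegrableOn (fun y ↦ Y (w - y)) (Icc 0 w) F := fun Y hY w hw ↦ by
    obtain ⟨C, hC⟩ := hY.locally_bounded x
    refine Integrable.of_bound (C := C)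
      (hY.measurable.comp (by fun_prop)).aestronglyMeasurable ?_
    filter_upwards [ae_restrict_mem measurableSet_Icc] with y hy
    exact hC _ (hmem x w hw y hy)
  obtain ⟨C₁, hC₁⟩ := hZ.locally_bounded x
  obtain ⟨C₂, hC₂⟩ := hZ'.locally_bounded x
  have hC : 0 ≤ C₁ + C₂ := add_nonneg ((abs_nonneg _).trans (hC₁ x ⟨not_lt.1 hx, le_rfl⟩))
    ((abs_nonneg _).trans (hC₂ x ⟨not_lt.1 hx, le_rfl⟩))
  -- The difference of two solutions solves the homogeneous equation; each iteration gains a factor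
  -- `F.real univ < 1`.
  have key : ∀ n : ℕ, ∀ w ∈ Icc 0 x, |Z w - Z' w| ≤ (C₁ + C₂) * F.real univ ^ n := by
    intro n
    induction n with
    | zero =>
      intro w hw
      rw [pow_zero, mul_one]
      exact (abs_sub _ _).trans (add_le_add (hC₁ w hw) (hC₂ w hw))
    | succ n ih =>
      intro w hw
      rw [hZ.equation w, hZ'.equation w, add_sub_add_left_eq_sub,
        ← integral_sub (hint Z hZ w hw) (hint Z' hZ' w hw), ← Real.norm_eq_abs, pow_succ,
        ← mul_assoc]
      refine (norm_setIntegral_le_of_norm_le_const (measure_lt_top _ _)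
        fun y hy ↦ ih _ (hmem x w hw y hy)).trans ?_
      exact mul_le_mul_of_nonneg_left (measureReal_mono (subset_univ _))
        (mul_nonneg hC (pow_nonneg measureReal_nonneg _))
  have hlim := (tendsto_pow_atTop_nhds_zero_of_lt_one measureReal_nonneg hF).const_mul (C₁ + C₂)
  rw [mul_zero] at hlim
  have h0 := ge_of_tendsto' hlim fun n ↦ key n x ⟨not_lt.1 hx, le_rfl⟩
  exact sub_eq_zero.1 (abs_nonpos_iff.1 h0)

/-! ### Necessity of `α ≤ 1`, by Laplace transforms -/

theorem gammaMeasure_Iio_zero (α : ℝ) : gammaMeasure α 1 (Iio 0) = 0 := by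
  rw [gammaMeasure, withDensity_apply _ measurableSet_Iio]
  exact lintegral_gammaPDF_of_nonpos le_rfl

/-- The Laplace transform of a geometric sum of laws on `[0, ∞)`. -/
theorem laplace_geometricSumLaw {r : ℝ} (hr : r ∈ Ioo (0 : ℝ) 1) (ν : Measure ℝ)
    [IsProbabilityMeasure ν] (hν : ν (Iio 0) = 0) {s : ℝ} (hs : 0 ≤ s)
    (hμ : geometricSumLaw r ν (Iio 0) = 0) :
    ∫ x, Real.exp (-(s * x)) ∂(geometricSumLaw r ν) =
      r * ∫ x, Real.exp (-(s * x)) ∂ν + (1 - r) *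
        ((∫ x, Real.exp (-(s * x)) ∂(geometricSumLaw r ν)) * ∫ x, Real.exp (-(s * x)) ∂ν) := by
  have := isProbabilityMeasure_geometricSumLaw hr ν
  have hm : Measurable fun x : ℝ ↦ ENNReal.ofReal (Real.exp (-(s * x))) := by fun_prop
  have hL : ∀ ρ : Measure ℝ, ∫ x, Real.exp (-(s * x)) ∂ρ =
      (∫⁻ x, ENNReal.ofReal (Real.exp (-(s * x))) ∂ρ).toReal := fun ρ ↦
    integral_eq_lintegral_of_nonneg_ae (.of_forall fun x ↦ (Real.exp_pos _).le)
      (by fun_prop)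
  have hfin : ∀ ρ : Measure ℝ, IsProbabilityMeasure ρ → ρ (Iio 0) = 0 →
      ∫⁻ x, ENNReal.ofReal (Real.exp (-(s * x))) ∂ρ ≠ ⊤ := fun ρ _ hρ ↦ by
    have h2 : ∀ᵐ y ∂ρ, 0 ≤ y := by
      rw [ae_iff]; simpa [not_le, Iio] using hρ
    refine ne_top_of_le_ne_top ENNReal.one_ne_top ?_
    calc _ ≤ ∫⁻ x, 1 ∂ρ := lintegral_mono_ae (by
            filter_upwards [h2] with x hx
            exact ENNReal.ofReal_le_one.2 (Real.exp_le_one_iff.2 (by nlinarith)))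
      _ = 1 := by simp
  have hN := hfin ν inferInstance hν
  have hM := hfin _ this hμ
  rw [hL, hL]
  conv_lhs => rw [geometricSumLaw_eq hr ν]
  rw [lintegral_add_measure, lintegral_smul_measure, lintegral_smul_measure,
    Measure.lintegral_conv hm]
  have hprod : ∀ x y : ℝ, ENNReal.ofReal (Real.exp (-(s * (x + y)))) =
      ENNReal.ofReal (Real.exp (-(s * x))) * ENNReal.ofReal (Real.exp (-(s * y))) := fun x y ↦ by
    rw [← ENNReal.ofReal_mul (Real.exp_pos _).le, ← Real.exp_add]
    ring_nf
  simp_rw [hprod, lintegral_const_mul _ hm]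
  rw [lintegral_mul_const _ hm, smul_eq_mul, smul_eq_mul, ENNReal.toReal_add
    (ENNReal.mul_ne_top ENNReal.ofReal_ne_top hN)
    (ENNReal.mul_ne_top ENNReal.ofReal_ne_top (ENNReal.mul_ne_top hM hN)), ENNReal.toReal_mul,
    ENNReal.toReal_mul, ENNReal.toReal_mul, ENNReal.toReal_ofReal hr.1.le,
    ENNReal.toReal_ofReal (sub_nonneg.2 hr.2.le)]

/-- The sum has exactly one term with probability `r > 0`, so the law dominates `r ν`. Geometric
divisibility allows any `ν` on the line; this puts it on the half-line, where Laplace transforms are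
finite. -/
theorem measure_Iio_zero_of_geometricSumLaw {r : ℝ} (hr : r ∈ Ioo (0 : ℝ) 1) (ν : Measure ℝ)
    [IsProbabilityMeasure ν] (h : geometricSumLaw r ν (Iio 0) = 0) : ν (Iio 0) = 0 := by
  rw [geometricSumLaw_eq hr ν, Measure.add_apply, add_eq_zero, Measure.smul_apply, smul_eq_mul,
    mul_eq_zero] at h
  exact h.1.resolve_left (by simpa using hr.1)

theorem le_one_of_isGID_geometricSumLaw_gammaMeasure {α : ℝ} (hα : 0 < α) {p : ℝ}
    (hp : p ∈ Ioo (0 : ℝ) 1) (h : IsGID (geometricSumLaw p (gammaMeasure α 1))) : α ≤ 1 := by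
  by_contra! hα1
  have := isProbabilityMeasure_gammaMeasure hα one_pos
  have hμ := geometricSumLaw_Iio_zero p _ (gammaMeasure_Iio_zero α)
  have hA : 1 < (2 : ℝ) ^ α := Real.one_lt_rpow (by norm_num) hα
  have hB : 1 < (3 : ℝ) ^ α := Real.one_lt_rpow (by norm_num) hα
  -- Strict midpoint convexity of `t ↦ t^α` at 1, 2, 3, the values of `1 + s` for `s = 0, 1, 2`.
  have hconv : 2 * (2 : ℝ) ^ α < 1 + (3 : ℝ) ^ α := by
    have := (strictConvexOn_rpow hα1).2 (mem_Ici.2 zero_le_one)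
      (mem_Ici.2 (zero_le_three (α := ℝ))) (by norm_num : (1 : ℝ) ≠ 3)
      (half_pos one_pos) (half_pos one_pos) (add_halves 1)
    norm_num at this
    linarith
  set A := (2 : ℝ) ^ α - 1
  set B := (3 : ℝ) ^ α - 1
  have hA0 : 0 < A := sub_pos.2 hA
  have hB0 : 0 < B := sub_pos.2 hB
  have hAB : 0 < B - 2 * A := by simp only [A, B]; linarith
  -- With `n(1) = p / (p + r A)` and `n(2) = p / (p + r B)`, the inequality `2 n(1) ≤ 1 + n(2)`
  -- reduces to `p (B - 2 A) ≤ r A B`; this `r` violates it.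
  obtain ⟨r, hr0, hr⟩ := exists_between (lt_min one_pos
    (div_pos (mul_pos hp.1 hAB) (mul_pos hA0 hB0)))
  have hr1 : r ∈ Ioo (0 : ℝ) 1 := ⟨hr0, hr.trans_le (min_le_left _ _)⟩
  have hr2 := (lt_div_iff₀ (mul_pos hA0 hB0)).1 (hr.trans_le (min_le_right _ _))
  obtain ⟨ν, hν, hμν⟩ := h r hr1
  have hν0 := measure_Iio_zero_of_geometricSumLaw hr1 ν (hμν ▸ hμ)
  have hν0' : ∀ᵐ y ∂ν, 0 ≤ y := by
    rw [ae_iff]; simpa [not_le, Iio] using hν0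
  have key : ∀ s : ℝ, 0 ≤ s →
      (∫ x, Real.exp (-(s * x)) ∂ν) * (p + r * ((1 + s) ^ α - 1)) = p := fun s hs ↦ by
    have h1 := laplace_geometricSumLaw hp _ (gammaMeasure_Iio_zero α) hs hμ
    have h2 := laplace_geometricSumLaw hr1 ν hν0 hs (hμν ▸ hμ)
    rw [← hμν] at h2
    rw [laplace_gammaMeasure α hα s hs] at h1
    have hu : 0 < (1 + s) ^ α := Real.rpow_pos_of_pos (by linarith) _
    set u := (1 + s) ^ α
    set N := ∫ x, Real.exp (-(s * x)) ∂ν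
    set M := ∫ x, Real.exp (-(s * x)) ∂(geometricSumLaw p (gammaMeasure α 1))
    have h3 : M * u = p + (1 - p) * M := by
      field_simp at h1
      linarith
    have hu1 : 1 ≤ u := Real.one_le_rpow (by linarith) hα.le
    have h4 : u - (1 - p) ≠ 0 := by linarith [hp.1]
    have h5 : M = p / (u - (1 - p)) := by rw [eq_div_iff h4]; linarith
    rw [h5] at h2
    field_simp at h2
    linarith
  have k1 := key 1 zero_le_one
  have k2 := key 2 zero_le_two
  rw [show (1 : ℝ) + 1 = 2 by norm_num] at k1
  rw [show (1 : ℝ) + 2 = 3 by norm_num] at k2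
  have hint : ∀ s : ℝ, 0 ≤ s → Integrable (fun x ↦ Real.exp (-(s * x))) ν := fun s hs ↦ by
    refine Integrable.of_bound (C := 1) (by fun_prop) ?_
    filter_upwards [hν0'] with x hx
    rw [Real.norm_eq_abs, Real.abs_exp]
    exact Real.exp_le_one_iff.2 (by nlinarith)
  -- This is `∫ (1 - e^{-x})² dν ≥ 0`, expanded.
  have hle : 2 * ∫ x, Real.exp (-(1 * x)) ∂ν ≤ 1 + ∫ x, Real.exp (-(2 * x)) ∂ν := by
    have h1 : 1 + ∫ x, Real.exp (-(2 * x)) ∂ν = (∫ _, (1 : ℝ) ∂ν) + ∫ x, Real.exp (-(2 * x)) ∂ν := by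
      simp
    rw [h1, ← integral_const_mul, ← integral_add (integrable_const _) (hint 2 zero_le_two)]
    refine integral_mono ((hint 1 zero_le_one).const_mul 2)
      ((integrable_const _).add (hint 2 zero_le_two)) fun x ↦ ?_
    have : Real.exp (-(2 * x)) = Real.exp (-(1 * x)) ^ 2 := by
      rw [← Real.exp_nat_mul]; congr 1; push_cast; ring
    simp only [this]
    nlinarith [sq_nonneg (Real.exp (-(1 * x)) - 1)]
  have d1 : 0 < p + r * A := by have := hp.1; positivity
  have d2 : 0 < p + r * B := by have := hp.1; positivity
  rw [← eq_div_iff d1.ne'] at k1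
  rw [← eq_div_iff d2.ne'] at k2
  rw [k1, k2, mul_div_assoc', one_add_div d2.ne', div_le_div_iff₀ d1 d2] at hle
  nlinarith

/-! ### The Mittag-Leffler series -/

/-- Only the part `t > M` of the Gamma integral is kept, where `t^(a-1) ≥ M^(a-1)`. As `M` is
arbitrary, Gamma outgrows every exponential, which is all that the convergence of the series needs.
-/
theorem rpow_mul_exp_neg_le_Gamma {a M : ℝ} (ha : 1 ≤ a) (hM : 0 < M) :
    M ^ (a - 1) * Real.exp (-M) ≤ Real.Gamma a := by
  have hint := Real.GammaIntegral_convergent (zero_lt_one.trans_le ha)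
  rw [Real.Gamma_eq_integral (zero_lt_one.trans_le ha), ← integral_exp_neg_Ioi,
    ← integral_const_mul]
  calc ∫ t in Ioi M, M ^ (a - 1) * Real.exp (-t)
      ≤ ∫ t in Ioi M, Real.exp (-t) * t ^ (a - 1) := by
        refine setIntegral_mono_on ((integrableOn_exp_neg_Ioi M).const_mul _)
          (hint.mono_set (Ioi_subset_Ioi hM.le)) measurableSet_Ioi fun t ht ↦ ?_
        rw [mul_comm]
        exact mul_le_mul_of_nonneg_left
          (Real.rpow_le_rpow hM.le (mem_Ioi.1 ht).le (sub_nonneg.2 ha)) (Real.exp_pos _).le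
    _ ≤ ∫ t in Ioi 0, Real.exp (-t) * t ^ (a - 1) := by
        refine setIntegral_mono_set hint ?_ (Ioi_subset_Ioi hM.le).eventuallyLE
        filter_upwards [ae_restrict_mem measurableSet_Ioi] with t ht
        have : (0 : ℝ) < t := ht
        simp only [Pi.zero_apply]
        positivity

/-- The Mittag-Leffler series `E_{α,α}` converges everywhere. -/
theorem summable_pow_div_Gamma {α : ℝ} (hα : 0 < α) (w : ℝ) :
    Summable fun n : ℕ ↦ w ^ n / Real.Gamma (α * (n + 1)) := by
  -- Chosen so that `M^α = 2|w| + 1`, which gives a geometric majorant of ratio `|w| / M^α < 1`.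
  set M : ℝ := (2 * |w| + 1) ^ (1 / α)
  have hb : 0 < 2 * |w| + 1 := by positivity
  have hM : 0 < M := Real.rpow_pos_of_pos hb _
  have hMα : M ^ α = 2 * |w| + 1 := by
    rw [← Real.rpow_mul hb.le, one_div_mul_cancel hα.ne', Real.rpow_one]
  have hratio : |w| / M ^ α < 1 := by
    rw [hMα, div_lt_one hb]; linarith [abs_nonneg w]
  refine Summable.of_norm_bounded_eventually_nat
    (g := fun n ↦ (Real.exp M / M ^ (α - 1)) * (|w| / M ^ α) ^ n)
    ((summable_geometric_of_lt_one (by positivity) hratio).mul_left _) ?_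
  obtain ⟨N, hN⟩ := exists_nat_gt (1 / α)
  filter_upwards [Filter.eventually_ge_atTop N] with n hn
  have hn' : (1 : ℝ) ≤ α * (n + 1) := by
    have h1 : (N : ℝ) ≤ n := by exact_mod_cast hn
    have h2 := (div_lt_iff₀ hα).1 hN
    nlinarith
  have hG := rpow_mul_exp_neg_le_Gamma hn' hM
  have hpos : 0 < M ^ (α * (n + 1) - 1) * Real.exp (-M) := by positivity
  rw [norm_div, norm_pow, Real.norm_eq_abs, Real.norm_of_nonneg (hpos.trans_le hG).le]
  calc |w| ^ n / Real.Gamma (α * (n + 1)) ≤ |w| ^ n / (M ^ (α * (n + 1) - 1) * Real.exp (-M)) := by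
        gcongr
    _ = _ := by
        rw [show α * ((n : ℝ) + 1) - 1 = (α - 1) + α * n by ring, Real.rpow_add hM,
          Real.rpow_mul hM.le, Real.rpow_natCast, Real.exp_neg, div_pow]
        field_simp

/-- The function `x ↦ E_{α,α}(-k x ^ α)`, where `E_{α,α}` is the Mittag-Leffler function. -/
def mittagLefflerNeg (α k x : ℝ) : ℝ :=
  ∑' n : ℕ, (-k * x ^ α) ^ n / Real.Gamma (α * (n + 1))

theorem continuous_mittagLefflerNeg {α : ℝ} (hα : 0 < α) (k : ℝ) :
    Continuous (mittagLefflerNeg α k) := by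
  have hE : Continuous fun w : ℝ ↦ ∑' n : ℕ, w ^ n / Real.Gamma (α * (n + 1)) := by
    rw [continuous_iff_continuousAt]
    intro w₀
    have hU : Icc (-(|w₀| + 1)) (|w₀| + 1) ∈ nhds w₀ :=
      Icc_mem_nhds (by linarith [neg_abs_le w₀]) (by linarith [le_abs_self w₀])
    refine (continuousOn_tsum (u := fun n : ℕ ↦ (|w₀| + 1) ^ n / Real.Gamma (α * (n + 1)))
      (fun n ↦ by fun_prop) (summable_pow_div_Gamma hα _) fun n w hw ↦ ?_).continuousAt hU
    have hΓ : 0 < Real.Gamma (α * (n + 1)) := Real.Gamma_pos_of_pos (by positivity)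
    rw [norm_div, norm_pow, Real.norm_eq_abs, Real.norm_of_nonneg hΓ.le]
    gcongr
    exact abs_le.2 hw
  exact hE.comp ((Real.continuous_rpow_const hα.le).const_mul (-k))

theorem mittagLefflerNeg_zero {α : ℝ} (hα : 0 < α) (k : ℝ) :
    mittagLefflerNeg α k 0 = 1 / Real.Gamma α := by
  rw [mittagLefflerNeg, tsum_eq_single 0 fun n hn ↦ by simp [Real.zero_rpow hα.ne', hn]]
  simp

/-! ### The Volterra equation and positivity -/

theorem integral_rpow_mul_sub_rpow {a b x : ℝ} (ha : 0 < a) (hb : 0 < b) (hx : 0 < x) :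
    ∫ y in 0..x, y ^ (a - 1) * (x - y) ^ (b - 1) =
      x ^ (a + b - 1) * (Real.Gamma a * Real.Gamma b / Real.Gamma (a + b)) := by
  have h := Complex.betaIntegral_scaled a b hx
  rw [Complex.betaIntegral_eq_Gamma_mul_div _ _ (by simpa) (by simpa)] at h
  have h1 : ∫ y in 0..x, (y : ℂ) ^ ((a : ℂ) - 1) * ((x : ℂ) - y) ^ ((b : ℂ) - 1) =
      ∫ y in 0..x, ((y ^ (a - 1) * (x - y) ^ (b - 1) : ℝ) : ℂ) := by
    refine intervalIntegral.integral_congr fun y hy ↦ ?_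
    rw [uIcc_of_le hx.le] at hy
    push_cast
    rw [Complex.ofReal_cpow hy.1, Complex.ofReal_cpow (sub_nonneg.2 hy.2)]
    push_cast
    rfl
  rw [h1, intervalIntegral.integral_ofReal] at h
  have h2 : (x : ℂ) ^ ((a : ℂ) + b - 1) = ((x ^ (a + b - 1) : ℝ) : ℂ) := by
    rw [Complex.ofReal_cpow hx.le]; push_cast; rfl
  rw [h2, ← Complex.ofReal_add, Complex.Gamma_ofReal, Complex.Gamma_ofReal,
    Complex.Gamma_ofReal] at h
  exact_mod_cast h

/-- A nonintegrable function has integral 0 by convention, whereas the Beta value is positive. -/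
theorem intervalIntegrable_rpow_mul_sub_rpow {a b x : ℝ} (ha : 0 < a) (hb : 0 < b) (hx : 0 < x) :
    IntervalIntegrable (fun y ↦ y ^ (a - 1) * (x - y) ^ (b - 1)) volume 0 x := by
  by_contra h
  have h1 := integral_rpow_mul_sub_rpow ha hb hx
  rw [intervalIntegral.integral_undef h] at h1
  have := Real.Gamma_pos_of_pos ha
  have := Real.Gamma_pos_of_pos hb
  have := Real.Gamma_pos_of_pos (add_pos ha hb)
  have : 0 < x ^ (a + b - 1) * (Real.Gamma a * Real.Gamma b / Real.Gamma (a + b)) := by positivity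
  exact this.ne h1

/-- The Volterra equation satisfied by `x ^ (α - 1) * E_{α,α}(-k x ^ α)`. -/
theorem mittagLefflerNeg_volterra {α k x : ℝ} (hα : 0 < α) (hx : 0 < x) :
    k * ∫ y in 0..x, y ^ (α - 1) * (x - y) ^ (α - 1) * mittagLefflerNeg α k y =
      x ^ (α - 1) * (1 - Real.Gamma α * mittagLefflerNeg α k x) := by
  have hΓ := Real.Gamma_pos_of_pos hα
  have hΓn : ∀ n : ℕ, 0 < Real.Gamma (α * (n + 1)) := fun n ↦
    Real.Gamma_pos_of_pos (by positivity)
  -- The integral is taken term by term; each Beta integral moves the series up by one index. The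
  -- parameter `κ` is `-k` for the series itself and `|k|` for the norms that justify the exchange.
  set F : ℝ → ℕ → ℝ → ℝ := fun κ n y ↦
    κ ^ n / Real.Gamma (α * (n + 1)) * (y ^ (α * (n + 1) - 1) * (x - y) ^ (α - 1)) with hF
  have hIF : ∀ κ n, ∫ y in Ioc 0 x, F κ n y =
      Real.Gamma α * x ^ (α - 1) * x ^ α *
        ((κ * x ^ α) ^ n / Real.Gamma (α * ((n + 1 : ℕ) + 1))) := fun κ n ↦ by
    rw [← intervalIntegral.integral_of_le hx.le, intervalIntegral.integral_const_mul,
      integral_rpow_mul_sub_rpow (by positivity) hα hx]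
    have h1 : α * ((n : ℝ) + 1) + α = α * ((n + 1 : ℕ) + 1) := by push_cast; ring
    have h2 := (hΓn n).ne'
    rw [h1, show α * (((n + 1 : ℕ) : ℝ) + 1) - 1 = (α - 1) + α + α * n by push_cast; ring,
      Real.rpow_add hx, Real.rpow_add hx, Real.rpow_mul hx.le, Real.rpow_natCast, mul_pow]
    field_simp
  have hFint : ∀ κ n, Integrable (F κ n) (volume.restrict (Ioc 0 x)) := fun κ n ↦
    ((intervalIntegrable_iff_integrableOn_Ioc_of_le hx.le).1
      (intervalIntegrable_rpow_mul_sub_rpow (by positivity) hα hx)).const_mul _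
  have hnorm : ∀ n, ∫ y in Ioc 0 x, ‖F (-k) n y‖ = ∫ y in Ioc 0 x, F |k| n y := fun n ↦ by
    refine setIntegral_congr_fun measurableSet_Ioc fun y hy ↦ ?_
    have h1 : 0 ≤ y ^ (α * (n + 1) - 1) * (x - y) ^ (α - 1) :=
      mul_nonneg (Real.rpow_nonneg hy.1.le _) (Real.rpow_nonneg (sub_nonneg.2 hy.2) _)
    simp only [hF, norm_mul, norm_div, norm_pow, norm_neg, Real.norm_eq_abs,
      abs_of_pos (hΓn n)]
    rw [← abs_mul, abs_of_nonneg h1]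
  have hsum : ∀ κ, Summable fun n : ℕ ↦ Real.Gamma α * x ^ (α - 1) * x ^ α *
      ((κ * x ^ α) ^ n / Real.Gamma (α * ((n + 1 : ℕ) + 1))) := fun κ ↦ by
    by_cases hκ : κ = 0
    · refine summable_of_ne_finset_zero (s := {0}) fun n hn ↦ ?_
      have : n ≠ 0 := by simpa using hn
      simp [hκ, this]
    · have h1 := ((summable_nat_add_iff 1).2 (summable_pow_div_Gamma hα (κ * x ^ α))).mul_left
        ((κ * x ^ α)⁻¹)
      refine (h1.mul_left (Real.Gamma α * x ^ (α - 1) * x ^ α)).congr fun n ↦ ?_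
      have h2 : κ * x ^ α ≠ 0 := mul_ne_zero hκ (Real.rpow_pos_of_pos hx _).ne'
      rw [pow_succ']
      field_simp
  have hS := hasSum_integral_of_summable_integral_norm (hFint (-k)) (by
    simp_rw [hnorm, hIF]; exact hsum _)
  have htsum : ∫ y in Ioc 0 x, ∑' n, F (-k) n y =
      ∫ y in 0..x, y ^ (α - 1) * (x - y) ^ (α - 1) * mittagLefflerNeg α k y := by
    rw [intervalIntegral.integral_of_le hx.le]
    refine setIntegral_congr_fun measurableSet_Ioc fun y hy ↦ ?_
    simp only [hF, mittagLefflerNeg]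
    rw [← tsum_mul_left]
    refine tsum_congr fun n ↦ ?_
    rw [show α * ((n : ℝ) + 1) - 1 = (α - 1) + α * n by ring, Real.rpow_add hy.1,
      Real.rpow_mul hy.1.le, Real.rpow_natCast, mul_pow]
    ring
  rw [htsum] at hS
  simp_rw [hIF] at hS
  -- The integrated series lacks the term `n = 0`, which is `1 / Γ(α)` and accounts for the 1 on the
  -- right-hand side.
  rw [← hS.tsum_eq, mittagLefflerNeg, (summable_pow_div_Gamma hα _).tsum_eq_zero_add, mul_add,
    ← tsum_mul_left, ← tsum_mul_left]
  have h0 : Real.Gamma α * ((-k * x ^ α) ^ 0 / Real.Gamma (α * ((0 : ℕ) + 1))) = 1 := by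
    simp [hΓ.ne']
  rw [h0, sub_add_cancel_left, ← tsum_neg, ← tsum_mul_left]
  refine tsum_congr fun n ↦ ?_
  rw [pow_succ]
  ring

theorem intervalIntegrable_mul_mittagLefflerNeg {α x : ℝ} (hα : 0 < α) (hx : 0 < x) (k : ℝ) :
    IntervalIntegrable (fun y ↦ y ^ (α - 1) * (x - y) ^ (α - 1) * mittagLefflerNeg α k y)
      volume 0 x :=
  (intervalIntegrable_rpow_mul_sub_rpow hα hα hx).mul_continuousOn
    (continuous_mittagLefflerNeg hα k).continuousOn

/-- Positivity comes from the log-convexity of `x ^ (α - 1)` for `α ≤ 1`, by comparing the Volterra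
equation at the first zero with the one at a maximizer shortly before. -/
theorem mittagLefflerNeg_pos {α k : ℝ} (hα : 0 < α) (hα1 : α ≤ 1) (hk : 0 < k) {x : ℝ}
    (hx : 0 ≤ x) : 0 < mittagLefflerNeg α k x := by
  set h := mittagLefflerNeg α k with hh
  have hcont : Continuous h := continuous_mittagLefflerNeg hα k
  have hΓ := Real.Gamma_pos_of_pos hα
  by_contra! hneg
  set S : Set ℝ := Ici 0 ∩ {y | h y ≤ 0}
  have hS : IsClosed S := isClosed_Ici.inter (isClosed_le hcont continuous_const)
  have hbdd : BddBelow S := ⟨0, fun y hy ↦ hy.1⟩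
  set x₀ := sInf S
  have hx₀S : x₀ ∈ S := hS.csInf_mem ⟨x, hx, hneg⟩ hbdd
  have hx₀h : h x₀ ≤ 0 := hx₀S.2
  have hx₀ : 0 < x₀ := by
    refine lt_of_le_of_ne hx₀S.1 fun h0 ↦ ?_
    rw [← h0, hh, mittagLefflerNeg_zero hα] at hx₀h
    exact absurd hx₀h (not_le.2 (one_div_pos.2 hΓ))
  have hpos : ∀ y, 0 ≤ y → y < x₀ → 0 < h y := fun y hy hy' ↦ by
    by_contra! hle
    exact absurd (csInf_le hbdd ⟨hy, hle⟩) (not_le.2 hy')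
  have hK := intervalIntegrable_rpow_mul_sub_rpow hα hα hx₀
  have hKsub : ∀ {u v : ℝ}, u ∈ Icc 0 x₀ → v ∈ Icc 0 x₀ →
      IntervalIntegrable (fun y ↦ y ^ (α - 1) * (x₀ - y) ^ (α - 1)) volume u v := fun hu hv ↦
    hK.mono_set (by rw [uIcc_of_le hx₀.le]; exact uIcc_subset_Icc hu hv)
  have hx₀p : 0 < x₀ ^ (α - 1) := Real.rpow_pos_of_pos hx₀ _
  -- The kernel is integrable, so its mass on `[x₁, x₀]` tends to 0 as `x₁` approaches the first
  -- zero `x₀`.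
  obtain ⟨x₁, hx₁, hW⟩ : ∃ x₁ ∈ Ioo 0 x₀,
      k * ∫ y in x₁..x₀, y ^ (α - 1) * (x₀ - y) ^ (α - 1) < Real.Gamma α * x₀ ^ (α - 1) := by
    have hc := intervalIntegral.continuousOn_primitive_interval (μ := volume)
      (f := fun y ↦ y ^ (α - 1) * (x₀ - y) ^ (α - 1)) (a := 0) (b := x₀) (by
        rw [uIcc_of_le hx₀.le]
        exact (intervalIntegrable_iff_integrableOn_Icc_of_le hx₀.le).1 hK)
    rw [uIcc_of_le hx₀.le] at hc
    have ht : Filter.Tendsto (fun t ↦ k * ((∫ y in 0..x₀, y ^ (α - 1) * (x₀ - y) ^ (α - 1)) -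
        ∫ y in 0..t, y ^ (α - 1) * (x₀ - y) ^ (α - 1))) (nhdsWithin x₀ (Ioo 0 x₀)) (nhds 0) := by
      have := ((tendsto_const_nhds (x := ∫ y in 0..x₀, y ^ (α - 1) * (x₀ - y) ^ (α - 1))).sub
        ((hc x₀ ⟨hx₀.le, le_rfl⟩).mono_left (nhdsWithin_mono _ Ioo_subset_Icc_self))).const_mul k
      simpa using this
    have hne : (nhdsWithin x₀ (Ioo 0 x₀)).NeBot := right_nhdsWithin_Ioo_neBot hx₀
    obtain ⟨t, ht1, ht2⟩ := ((ht.eventually_lt_const (mul_pos hΓ hx₀p)).and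
      self_mem_nhdsWithin).exists
    refine ⟨t, ht2, ?_⟩
    rwa [intervalIntegral.integral_interval_sub_left hK
      (hKsub ⟨le_rfl, hx₀.le⟩ ⟨ht2.1.le, ht2.2.le⟩)] at ht1
  obtain ⟨z, hz, hmax⟩ := isCompact_Icc.exists_isMaxOn (nonempty_Icc.2 hx₁.2.le)
    hcont.continuousOn
  have hzpos : 0 < h z := (hpos x₁ hx₁.1.le hx₁.2).trans_le (hmax ⟨le_rfl, hx₁.2.le⟩)
  have hz0 : 0 < z := hx₁.1.trans_le hz.1
  have hzlt : z < x₀ := lt_of_le_of_ne hz.2 fun he ↦ by rw [he] at hzpos; linarith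
  have hzp : 0 < z ^ (α - 1) := Real.rpow_pos_of_pos hz0 _
  have hKh := intervalIntegrable_mul_mittagLefflerNeg hα hx₀ k
  have hKh1 : IntervalIntegrable (fun y ↦ y ^ (α - 1) * (x₀ - y) ^ (α - 1) * h y) volume 0 z :=
    hKh.mono_set (by rw [uIcc_of_le hx₀.le, uIcc_of_le hz0.le]; exact Icc_subset_Icc_right hz.2)
  have hKh2 : IntervalIntegrable (fun y ↦ y ^ (α - 1) * (x₀ - y) ^ (α - 1) * h y) volume z x₀ :=
    hKh.mono_set (by
      rw [uIcc_of_le hx₀.le, uIcc_of_le hzlt.le]; exact Icc_subset_Icc_left hz0.le)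
  -- Since `z (x₀ - y) ≥ x₀ (z - y)` and `α - 1 ≤ 0`, the kernel ratio `(x₀ - y)^(α-1) / (z -
  -- y)^(α-1)` is at most `x₀^(α-1) / z^(α-1)`. The open interval matters: at `y = z` and `α < 1`
  -- the convention `0^(α-1) = 0` breaks the comparison.
  have hfirst : z ^ (α - 1) * (∫ y in 0..z, y ^ (α - 1) * (x₀ - y) ^ (α - 1) * h y) ≤
      x₀ ^ (α - 1) * ∫ y in 0..z, y ^ (α - 1) * (z - y) ^ (α - 1) * h y := by
    rw [← intervalIntegral.integral_const_mul, ← intervalIntegral.integral_const_mul]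
    refine intervalIntegral.integral_mono_on_of_le_Ioo hz0.le (hKh1.const_mul _)
      ((intervalIntegrable_mul_mittagLefflerNeg hα hz0 k).const_mul _) fun y hy ↦ ?_
    have hy1 : 0 < z - y := sub_pos.2 hy.2
    have hy2 : 0 < x₀ - y := by linarith
    have hle : (z * (x₀ - y)) ^ (α - 1) ≤ (x₀ * (z - y)) ^ (α - 1) :=
      Real.rpow_le_rpow_of_nonpos (mul_pos hx₀ hy1) (by nlinarith [hy.1]) (by linarith)
    rw [Real.mul_rpow hz0.le hy2.le, Real.mul_rpow hx₀.le hy1.le] at hle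
    have hn : 0 ≤ y ^ (α - 1) * h y :=
      mul_nonneg (Real.rpow_nonneg hy.1.le _) (hpos y hy.1.le (by linarith)).le
    nlinarith [mul_le_mul_of_nonneg_left hle hn]
  have hsecond : (∫ y in z..x₀, y ^ (α - 1) * (x₀ - y) ^ (α - 1) * h y) ≤
      h z * ∫ y in x₁..x₀, y ^ (α - 1) * (x₀ - y) ^ (α - 1) := by
    have hzI : z ∈ Icc 0 x₀ := ⟨hz0.le, hz.2⟩
    have hx₁I : x₁ ∈ Icc 0 x₀ := ⟨hx₁.1.le, hx₁.2.le⟩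
    have hx₀I : x₀ ∈ Icc 0 x₀ := ⟨hx₀.le, le_rfl⟩
    have hnn : ∀ u v, 0 ≤ u → u ≤ v → v ≤ x₀ →
        0 ≤ ∫ y in u..v, y ^ (α - 1) * (x₀ - y) ^ (α - 1) := fun u v hu huv hv ↦
      intervalIntegral.integral_nonneg huv fun y hy ↦
        mul_nonneg (Real.rpow_nonneg (hu.trans hy.1) _)
          (Real.rpow_nonneg (sub_nonneg.2 (hy.2.trans hv)) _)
    calc _ ≤ ∫ y in z..x₀, h z * (y ^ (α - 1) * (x₀ - y) ^ (α - 1)) := by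
          refine intervalIntegral.integral_mono_on hz.2 hKh2
            ((hKsub hzI hx₀I).const_mul _) fun y hy ↦ ?_
          rw [mul_comm (h z)]
          exact mul_le_mul_of_nonneg_left (hmax ⟨hz.1.trans hy.1, hy.2⟩)
            (mul_nonneg (Real.rpow_nonneg (hz0.le.trans hy.1) _)
              (Real.rpow_nonneg (sub_nonneg.2 hy.2) _))
      _ ≤ _ := by
          rw [intervalIntegral.integral_const_mul, ← intervalIntegral.integral_add_adjacent_intervals
            (hKsub hx₁I hzI) (hKsub hzI hx₀I)]
          exact mul_le_mul_of_nonneg_left (le_add_of_nonneg_left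
            (hnn x₁ z hx₁.1.le hz.1 hz.2)) hzpos.le
  have hV₀ := mittagLefflerNeg_volterra (k := k) hα hx₀
  have hVz := mittagLefflerNeg_volterra (k := k) hα hz0
  rw [← hh] at hV₀ hVz
  rw [← intervalIntegral.integral_add_adjacent_intervals hKh1 hKh2] at hV₀
  set I₁ := ∫ y in 0..z, y ^ (α - 1) * (x₀ - y) ^ (α - 1) * h y
  set I₂ := ∫ y in z..x₀, y ^ (α - 1) * (x₀ - y) ^ (α - 1) * h y
  set J := ∫ y in 0..z, y ^ (α - 1) * (z - y) ^ (α - 1) * h y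
  set W := ∫ y in x₁..x₀, y ^ (α - 1) * (x₀ - y) ^ (α - 1)
  set A := x₀ ^ (α - 1)
  set B := z ^ (α - 1)
  have e1 : A ≤ k * (I₁ + I₂) := by
    rw [hV₀]
    exact le_mul_of_one_le_right hx₀p.le (by nlinarith)
  have e2 : B * A ≤ B * (k * (I₁ + I₂)) := mul_le_mul_of_nonneg_left e1 hzp.le
  have e3 : k * (B * I₁) ≤ A * (k * J) := by nlinarith
  rw [hVz] at e3
  have e4 : k * B * I₂ ≤ k * B * (h z * W) :=
    mul_le_mul_of_nonneg_left hsecond (mul_nonneg hk.le hzp.le)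
  have e5 : (k * W) * (B * h z) < (Real.Gamma α * A) * (B * h z) :=
    mul_lt_mul_of_pos_right hW (mul_pos hzp hzpos)
  -- Together these give `Γ(α) A B h(z) ≤ k W B h(z)`, against the choice of `x₁`.
  linarith

/-! ### Sufficiency of `α ≤ 1` -/

/-- The law with Laplace transform `1 / (1 - c + c * (1 + s) ^ α)`, for `α ≤ 1`, given by its
convolution equation with the gamma law. -/
theorem exists_smul_add_conv_eq_gammaMeasure {α : ℝ} (hα : 0 < α) (hα1 : α ≤ 1) {c : ℝ}
    (hc : c ∈ Ioo (0 : ℝ) 1) :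
    ∃ ν : Measure ℝ, IsProbabilityMeasure ν ∧
      ENNReal.ofReal c • ν + ENNReal.ofReal (1 - c) • Measure.conv ν (gammaMeasure α 1) =
        gammaMeasure α 1 := by
  have hG := isProbabilityMeasure_gammaMeasure hα one_pos
  have hΓ := Real.Gamma_pos_of_pos hα
  have hc1 : 0 < 1 - c := sub_pos.2 hc.2
  -- `x^(α-1) E_{α,α}(-k x^α)` has transform `1 / (s^α + k)`; the factor `e^{-x}` shifts `s` to `1 +
  -- s`, and division by `c` yields `1 / (c (1 + s)^α + 1 - c)`.
  set k := (1 - c) / c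
  have hk : 0 < k := div_pos hc1 hc.1
  set h := mittagLefflerNeg α k with hh
  set f : ℝ → ℝ := fun x ↦ Real.Gamma α / c * (gammaPDFReal α 1 x * h x) with hf
  have hfm : Measurable f := by
    have := (continuous_mittagLefflerNeg hα k).measurable
    fun_prop
  have hf0 : ∀ x, 0 ≤ f x := fun x ↦ by
    by_cases hx : 0 ≤ x
    · have h1 := gammaPDFReal_nonneg hα one_pos x
      have h2 := mittagLefflerNeg_pos hα hα1 hk hx
      have := hc.1
      positivity
    · simp [hf, gammaPDFReal, hx]
  have hconv : ∀ x, 0 < x → ENNReal.ofReal (1 - c) *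
      ((fun y ↦ ENNReal.ofReal (f y)) ⋆ₗ[volume] gammaPDF α 1) x =
      ENNReal.ofReal (gammaPDFReal α 1 x - c * f x) := fun x hx ↦ by
    have hint : IntegrableOn (fun y ↦ Real.exp (-x) / (c * Real.Gamma α) *
        (y ^ (α - 1) * (x - y) ^ (α - 1) * h y)) (Icc 0 x) :=
      ((intervalIntegrable_iff_integrableOn_Icc_of_le hx.le).1
        (intervalIntegrable_mul_mittagLefflerNeg hα hx k)).const_mul _
    have hnn : ∀ y ∈ Icc 0 x, 0 ≤ Real.exp (-x) / (c * Real.Gamma α) *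
        (y ^ (α - 1) * (x - y) ^ (α - 1) * h y) := fun y hy ↦ by
      have h1 := Real.rpow_nonneg hy.1 (α - 1)
      have h2 := Real.rpow_nonneg (sub_nonneg.2 hy.2) (α - 1)
      have h3 := mittagLefflerNeg_pos hα hα1 hk hy.1
      have := hc.1
      positivity
    have hlc : ((fun y ↦ ENNReal.ofReal (f y)) ⋆ₗ[volume] gammaPDF α 1) x =
        ∫⁻ y in Icc 0 x, ENNReal.ofReal (Real.exp (-x) / (c * Real.Gamma α) *
          (y ^ (α - 1) * (x - y) ^ (α - 1) * h y)) := by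
      rw [lconvolution_def, ← lintegral_indicator measurableSet_Icc]
      refine lintegral_congr fun y ↦ ?_
      rw [gammaPDF, ← ENNReal.ofReal_mul (hf0 y)]
      by_cases hy : y ∈ Icc 0 x
      · rw [indicator_of_mem hy]
        congr 1
        have h1 : 0 ≤ -y + x := by linarith [hy.2]
        simp only [hf, gammaPDFReal, if_pos hy.1, if_pos h1, Real.one_rpow, one_mul]
        rw [show -x = -y + -(-y + x) by ring, Real.exp_add, show -y + x = x - y by ring]
        have := hc.1.ne'
        field_simp
      · rw [indicator_of_notMem hy]
        by_cases hy0 : 0 ≤ y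
        · have h1 : ¬ 0 ≤ -y + x := fun h1 ↦ hy ⟨hy0, by linarith⟩
          simp [gammaPDFReal, h1]
        · simp [hf, gammaPDFReal, hy0]
    rw [hlc, ← ofReal_integral_eq_lintegral_ofReal hint
      ((ae_restrict_mem measurableSet_Icc).mono hnn), ← ENNReal.ofReal_mul hc1.le,
      integral_const_mul, integral_Icc_eq_integral_Ioc, ← intervalIntegral.integral_of_le hx.le]
    congr 1
    have hV := mittagLefflerNeg_volterra (k := k) hα hx
    rw [← hh] at hV
    have hkc : 1 - c = k * c := by
      simp only [k]; field_simp [hc.1.ne']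
    simp only [hf, gammaPDFReal, if_pos hx.le, Real.one_rpow, one_mul]
    rw [hkc]
    have := hc.1.ne'
    calc _ = Real.exp (-x) / Real.Gamma α *
          (k * ∫ y in 0..x, y ^ (α - 1) * (x - y) ^ (α - 1) * h y) := by field_simp
      _ = _ := by rw [hV]; field_simp
  -- Needed because truncated `ENNReal.ofReal` values are added: the convolution term `gammaPDFReal
  -- α 1 x - c * f x` must be nonnegative, and it is a positive multiple of the Volterra integral.
  have hfle : ∀ x, 0 < x → c * f x ≤ gammaPDFReal α 1 x := fun x hx ↦ by
    have hV := mittagLefflerNeg_volterra (k := k) hα hx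
    rw [← hh] at hV
    have h1 : 0 ≤ k * ∫ y in 0..x, y ^ (α - 1) * (x - y) ^ (α - 1) * h y :=
      mul_nonneg hk.le (intervalIntegral.integral_nonneg hx.le fun y hy ↦
        mul_nonneg (mul_nonneg (Real.rpow_nonneg hy.1 _)
          (Real.rpow_nonneg (sub_nonneg.2 hy.2) _)) (mittagLefflerNeg_pos hα hα1 hk hy.1).le)
    rw [hV] at h1
    have h2 := nonneg_of_mul_nonneg_right h1 (Real.rpow_pos_of_pos hx _)
    have h3 : c * f x = gammaPDFReal α 1 x * (Real.Gamma α * h x) := by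
      simp only [hf]; field_simp [hc.1.ne']
    rw [h3]
    exact mul_le_of_le_one_right (gammaPDFReal_nonneg hα one_pos x) (sub_nonneg.1 h2)
  set ν := volume.withDensity fun y ↦ ENNReal.ofReal (f y)
  have hfm' : Measurable fun y ↦ ENNReal.ofReal (f y) := hfm.ennreal_ofReal
  have hgm : Measurable (gammaPDF α 1) := (measurable_gammaPDFReal α 1).ennreal_ofReal
  have heq : ENNReal.ofReal c • ν + ENNReal.ofReal (1 - c) • Measure.conv ν (gammaMeasure α 1) =
      gammaMeasure α 1 := by
    rw [gammaMeasure, conv_withDensity_eq_lconvolution hfm' hgm, ← withDensity_smul _ hfm',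
      ← withDensity_smul _ (measurable_lconvolution _ hfm' hgm),
      ← withDensity_add_left (hfm'.const_smul _)]
    refine withDensity_congr_ae ?_
    filter_upwards [Measure.ae_ne volume (0 : ℝ)] with x hx
    simp only [Pi.add_apply, Pi.smul_apply, smul_eq_mul]
    rcases lt_or_gt_of_ne hx with hx | hx
    · have h1 : ∀ y, ENNReal.ofReal (f y) * gammaPDF α 1 (-y + x) = 0 := fun y ↦ by
        by_cases hy : 0 ≤ y
        · rw [gammaPDF_of_neg (by linarith), mul_zero]
        · simp [hf, gammaPDFReal, hy]
      rw [lconvolution_def, gammaPDF_of_neg hx]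
      have h2 : f x = 0 := by simp [hf, gammaPDFReal, hx.not_ge]
      simp only [h1, h2, lintegral_zero, ENNReal.ofReal_zero, mul_zero, add_zero]
    · rw [hconv x hx, ← ENNReal.ofReal_mul hc.1.le,
        ← ENNReal.ofReal_add (mul_nonneg hc.1.le (hf0 x)) (sub_nonneg.2 (hfle x hx)),
        add_sub_cancel, gammaPDF]
  refine ⟨ν, ⟨?_⟩, heq⟩
  -- Comparing total masses shows that `ν` has mass 1, so the density need not be integrated
  -- directly.
  have hmass := congrArg (fun ρ : Measure ℝ ↦ ρ univ) heq
  have hcv : Measure.conv ν (gammaMeasure α 1) univ = ν univ := by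
    rw [← lintegral_one, Measure.lintegral_conv measurable_const]
    simp
  simp only [Measure.add_apply, Measure.smul_apply, smul_eq_mul, measure_univ, hcv] at hmass
  rwa [← add_mul, ← ENNReal.ofReal_add hc.1.le hc1.le, add_sub_cancel, ENNReal.ofReal_one,
    one_mul] at hmass

/-- The summand law must satisfy `1/n - 1 = (r/p) (1/g - 1)`. For `r < p` this is the Mittag-Leffler
law with `c = r/p`; for `r > p` it is a geometric sum with parameter `p/r`, as a geometric(`r`) sum
of geometric(`p/r`) sums is a geometric(`p`) sum. -/
theorem isGID_geometricSumLaw_gammaMeasure {α : ℝ} (hα : 0 < α) (hα1 : α ≤ 1) {p : ℝ}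
    (hp : p ∈ Ioo (0 : ℝ) 1) : IsGID (geometricSumLaw p (gammaMeasure α 1)) := by
  have := isProbabilityMeasure_gammaMeasure hα one_pos
  have := isProbabilityMeasure_geometricSumLaw hp (gammaMeasure α 1)
  intro r hr
  have hr0 : (r : ℂ) ≠ 0 := Complex.ofReal_ne_zero.2 hr.1.ne'
  rcases lt_trichotomy r p with hrp | rfl | hrp
  · have hc : r / p ∈ Ioo (0 : ℝ) 1 := ⟨div_pos hr.1 hp.1, (div_lt_one hp.1).2 hrp⟩
    have hp0 : (p : ℂ) ≠ 0 := Complex.ofReal_ne_zero.2 hp.1.ne'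
    obtain ⟨ν, hν, heq⟩ := exists_smul_add_conv_eq_gammaMeasure hα hα1 hc
    refine ⟨ν, hν, eq_geometricSumLaw_of_charFun hr _ _ fun t ↦ ?_⟩
    have h1 := charFun_geometricSumLaw hp (gammaMeasure α 1) t
    have : IsFiniteMeasure (ENNReal.ofReal (r / p) • ν) :=
      Measure.smul_finite _ ENNReal.ofReal_ne_top
    have : IsFiniteMeasure (ENNReal.ofReal (1 - r / p) • Measure.conv ν (gammaMeasure α 1)) :=
      Measure.smul_finite _ ENNReal.ofReal_ne_top
    have h2 := congrArg (fun ρ : Measure ℝ ↦ charFun ρ t) heq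
    simp only [charFun_add, charFun_ofReal_smul hc.1.le,
      charFun_ofReal_smul (sub_nonneg.2 hc.2.le), charFun_conv] at h2
    push_cast at h2
    have h3 := one_sub_mul_charFun_ne_zero hp (gammaMeasure α 1) t
    refine mul_left_cancel₀ h3 ?_
    set g := charFun (gammaMeasure α 1) t
    set m := charFun (geometricSumLaw p (gammaMeasure α 1)) t
    set n := charFun ν t
    have h4 : r * n + (p - r) * (n * g) = p * g := by
      have e : (p : ℂ) * (r / p) = r := mul_div_cancel₀ _ hp0
      linear_combination (p : ℂ) * h2 - (n - n * g) * e
    linear_combination (1 - (1 - (r : ℂ)) * n) * h1 - h4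
  · exact ⟨gammaMeasure α 1, inferInstance, rfl⟩
  · have hc : p / r ∈ Ioo (0 : ℝ) 1 := ⟨div_pos hp.1 hr.1, (div_lt_one hr.1).2 hrp⟩
    have hν := isProbabilityMeasure_geometricSumLaw hc (gammaMeasure α 1)
    refine ⟨_, hν, eq_geometricSumLaw_of_charFun hr _ _ fun t ↦ ?_⟩
    have h1 := charFun_geometricSumLaw hp (gammaMeasure α 1) t
    have h2 := charFun_geometricSumLaw hc (gammaMeasure α 1) t
    push_cast at h2
    refine mul_left_cancel₀ (one_sub_mul_charFun_ne_zero hp (gammaMeasure α 1) t) ?_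
    set g := charFun (gammaMeasure α 1) t
    set m := charFun (geometricSumLaw p (gammaMeasure α 1)) t
    set n := charFun (geometricSumLaw (p / r) (gammaMeasure α 1)) t
    have h4 : r * n = p * g + (r - p) * (n * g) := by
      conv_lhs => rw [h2]
      field_simp
    linear_combination (1 - (1 - (r : ℂ)) * n) * h1 - h4

end

end RenewalGID

theorem corollary2p5 (α : ℝ) (hα : 0 < α) (p : ℝ) (hp : p ∈ Set.Ioo (0 : ℝ) 1) :
    ∃ μ : MeasureTheory.Measure ℝ,
      MeasureTheory.IsProbabilityMeasure μ ∧
      -- the distribution function of `μ` solves `Z = p G + Z * (q G)`, with `q = 1 - p`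
      RenewalGID.IsRenewalSolution
        (fun x => p * ProbabilityTheory.cdf (ProbabilityTheory.gammaMeasure α 1) x)
        (ENNReal.ofReal (1 - p) • ProbabilityTheory.gammaMeasure α 1)
        (fun x => ProbabilityTheory.cdf μ x) ∧
      -- there is no other solution
      (∀ Z : ℝ → ℝ,
        RenewalGID.IsRenewalSolution
          (fun x => p * ProbabilityTheory.cdf (ProbabilityTheory.gammaMeasure α 1) x)
          (ENNReal.ofReal (1 - p) • ProbabilityTheory.gammaMeasure α 1) Z →
        Z = fun x => ProbabilityTheory.cdf μ x) ∧
      (RenewalGID.IsGID μ ↔ α ≤ 1) := by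
  have := ProbabilityTheory.isProbabilityMeasure_gammaMeasure hα one_pos
  have hsol := RenewalGID.isRenewalSolution_cdf_geometricSumLaw hp
    (ProbabilityTheory.gammaMeasure α 1) (RenewalGID.gammaMeasure_Iio_zero α)
  have hfin : IsFiniteMeasure
      (ENNReal.ofReal (1 - p) • ProbabilityTheory.gammaMeasure α 1) :=
    Measure.smul_finite _ ENNReal.ofReal_ne_top
  refine ⟨_, RenewalGID.isProbabilityMeasure_geometricSumLaw hp _, hsol, fun Z hZ ↦ ?_,
    RenewalGID.le_one_of_isGID_geometricSumLaw_gammaMeasure hα hp,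
    fun hα1 ↦ RenewalGID.isGID_geometricSumLaw_gammaMeasure hα hα1 hp⟩
  refine hZ.unique ?_ hsol
  rw [measureReal_ennreal_smul_apply, ENNReal.toReal_ofReal (sub_nonneg.2 hp.2.le),
    probReal_univ, mul_one]
  linarith [hp.1]
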